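/- **Setting.** There are $N$ objects with a binary adjacency matrix $(e^{i,j})$ and inclusive neighbourhoods $\mathcal E(i)=\{j: e^{i,j}=1\}\cup\{i\}$. Object $i$ has compact Hausdorff observation, action and history spaces $\mathbb O^i,\mathbb A^i,\mathbb H^i$ (with their Borel $\sigma$-algebras), each carrying a real reproducing kernel Hilbert space with continuous characteristic kernel; the canonical feature maps are $\phi_{\mathbb O^i},\phi_{\mathbb A^i},\phi_{\mathbb H^i}$, and $\mathcal H_{\mathbb O^i}$ is the RKHS of $\mathbb O^i$. (Characteristic: the kernel mean $m_P=\int\phi\,dP$ is injective on Borel probability measures.) For an input $x=\{a^j,h^j\}_{j=1}^N$ put $\psi^{h,j}=\phi_{\mathbb H^j}(h^j)$, $\psi^{a,j}=\phi_{\mathbb A^j}(a^j)$; $\otimes$ is the Hilbert space tensor product. Let $\big(O_t^i,\;A_t^j,H_t^j,\;\psi_t^{O,i,j}\big)_{i,j\in[N]}$, $t=0,1,2,\dots$, be i.i.d. samples, where $\psi^{O,i,j}_t$ is an $\mathcal H_{\mathbb O^i}$-valued random element, bounded by a constant almost surely (the component of the observation feature of object $i$ attributable to object $j$). Let $P(O^i\mid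 x)$ be a version of the conditional distribution of $O_t^i$ given $\{A_t^j,H_t^j\}_{j=1}^N$. Let $\mathcal C_{O^i|A^jH^j}$ be bounded linear operators from $\mathcal H_{\mathbb H^j}\otimes\mathcal H_{\mathbb A^j}$ to $\mathcal H_{\mathbb O^i}$ such that for all $i$ and all $j\in\mathcal E(i)$, almost surely, $$\mathbb E[\psi_t^{O,i,j}\mid A_t^j,H_t^j]=\mathcal C_{O^i|A^jH^j}\big[\phi_{\mathbb H^j}(H_t^j)\otimes\phi_{\mathbb A^j}(A_t^j)\big],$$ and such that, for all $i$ and every $x$ in the support of the law of the inputs $\{A^j_t,H^j_t\}_{j=1}^N$, $$\int\phi_{\mathbb O^i}(o)\,P(do\mid x)=\sum_{j\in\mathcal E(i)}\mathcal C_{O^i|A^jH^j}[\psi^{h,j}\otimes\psi^{a,j}].$$ The left side is the conditional mean embedding $\mathbb E[\psi^{O,i}\mid x]$. For real $\lambda_T$ with $\lambda_T\to0$ and $T\lambda_T\to\infty$ let, with $z_t^j=\phi_{\mathbb H^j}(H_t^j)\otimes\phi_{\mathbb A^j}(A_t^j)$, $$\widehat{\mathcal C}_{O^i|A^jH^j}=\Big(\tfrac1T\sum_{t<T}\psi_t^{O,i,j}\otimes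 z_t^j\Big)\Big(\tfrac1T\sum_{t<T}z_t^j\otimes z_t^j+\lambda_T I\Big)^{-1},\qquad \widehat\psi_T^{O,i}(x)=\sum_{j\in\mathcal E(i)}\widehat{\mathcal C}_{O^i|A^jH^j}[\psi^{h,j}\otimes\psi^{a,j}].$$ (The inverse exists for all large $T$, since then $\lambda_T>0$.) **Theorem (Consistency and convergence of GCE).** For every $i$ and every input $x$ in the support of the law of the inputs, as $T\to\infty$: 1. $\big\|\widehat\psi_T^{O,i}(x)-\mathbb E[\psi^{O,i}\mid x]\big\|_{\mathcal H_{\mathbb O^i}}\to0$ in probability. 2. The induced conditional distributions converge to $P(O^i\mid x)$, where $\mathrm{MMD}(P,Q)=\|m_P-m_Q\|$: (a) if $\widehat P_T$ are (random) finite signed measures on $\mathbb O^i$ with kernel mean $\widehat\psi_T^{O,i}(x)$, then $\mathrm{MMD}(\widehat P_T,P(O^i\mid x))\to0$ in probability; (b) there always exist probability measures $\widehat P_T$ on $\mathbb O^i$ whose kernel mean has minimal distance to $\widehat\psi_T^{O,i}(x)$ (so it equals $\widehat\psi_T^{O,i}(x)$ whenever that is the kernel mean of a probability measure), and for any such choice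 $\mathrm{MMD}(\widehat P_T,P(O^i\mid x))\to0$ in probability and $\int f\,d\widehat P_T\to\int f\,dP(\cdot\mid x)$ in probability for every continuous $f:\mathbb O^i\to\mathbb R$. -/

import Mathlib

open MeasureTheory ProbabilityTheory Filter Topology
open scoped TensorProduct ENNReal

namespace GCE

noncomputable section

/-! ### Kernel features, kernel means, characteristic kernels -/

section KernelMean

variable {X : Type*} (H : Type*) [NormedAddCommGroup H] [InnerProductSpace ℝ H] [CompleteSpace H]
  [RKHS ℝ H X ℝ]

/-- The canonical feature map `x ↦ k(·, x)` of a (scalar, real) reproducing kernel Hilbert space. -/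
def featureMap (x : X) : H := RKHS.kerFun H x 1

/-- The reproducing property `⟪f, k(·, x)⟫ = f x`. -/
theorem inner_featureMap (f : H) (x : X) : inner ℝ f (featureMap H x) = f x := by
  simp [featureMap]

variable [MeasurableSpace X]

/-- The kernel mean embedding `∫ k(·, x) dP(x)` of a measure. -/
def kernelMean (P : Measure X) : H := ∫ x, featureMap H x ∂P

/-- The kernel mean embedding of a finite signed measure, through its Jordan decomposition. -/
def signedKernelMean (ν : SignedMeasure X) : H :=
  kernelMean H ν.toJordanDecomposition.posPart - kernelMean H ν.toJordanDecomposition.negPart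

/-- Maximum mean discrepancy of two measures. -/
def mmd (P Q : Measure X) : ℝ := ‖kernelMean H P - kernelMean H Q‖

/-- Maximum mean discrepancy of a finite signed measure and a measure. -/
def signedMMD (ν : SignedMeasure X) (Q : Measure X) : ℝ :=
  ‖signedKernelMean H ν - kernelMean H Q‖

/-- The kernel is characteristic: the kernel mean is injective on probability measures. -/
def IsCharacteristic : Prop :=
  ∀ P Q : ProbabilityMeasure X,
    kernelMean H (P : Measure X) = kernelMean H (Q : Measure X) → P = Q

variable {H} in
/-- `P` is a probability measure whose kernel mean is as close as possible to `ψ`. If `ψ` is the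
kernel mean of some probability measure, this says exactly that `P` has kernel mean `ψ`. -/
def IsInducedBy (P : ProbabilityMeasure X) (ψ : H) : Prop :=
  ∀ Q : ProbabilityMeasure X,
    ‖kernelMean H (P : Measure X) - ψ‖ ≤ ‖kernelMean H (Q : Measure X) - ψ‖

end KernelMean

/-! ### Tensor features -/

/-- The Hilbert space tensor product: completion of the algebraic tensor product with the inner
product `⟪a ⊗ b, c ⊗ d⟫ = ⟪a, c⟫ * ⟪b, d⟫`. -/
abbrev HilbertTensor (E F : Type*) [NormedAddCommGroup E] [InnerProductSpace ℝ E]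
    [NormedAddCommGroup F] [InnerProductSpace ℝ F] : Type _ :=
  UniformSpace.Completion (E ⊗[ℝ] F)

section TensorFeature

variable {A S : Type*} (HA HS : Type*)
  [NormedAddCommGroup HA] [InnerProductSpace ℝ HA] [CompleteSpace HA] [RKHS ℝ HA A ℝ]
  [NormedAddCommGroup HS] [InnerProductSpace ℝ HS] [CompleteSpace HS] [RKHS ℝ HS S ℝ]

/-- The tensor feature `ψ^h ⊗ ψ^a` of an (action, history) pair `(a, h)`. -/
def tensorFeature (x : A × S) : HilbertTensor HS HA :=
  ((featureMap HS x.2 ⊗ₜ[ℝ] featureMap HA x.1 : HS ⊗[ℝ] HA) : HilbertTensor HS HA)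

end TensorFeature

/-! ### Conditional embedding operators and their empirical estimators -/

/-- `C` is the conditional embedding operator of the Hilbert space valued random element `Y` given
the random variable `X` with feature map `φ`:  `E[Y | X] = C (φ X)` almost surely. -/
def IsCondEmbeddingOperator {Ω 𝒳 F G : Type*} [MeasurableSpace Ω] [MeasurableSpace 𝒳]
    [NormedAddCommGroup F] [InnerProductSpace ℝ F]
    [NormedAddCommGroup G] [InnerProductSpace ℝ G] [CompleteSpace G]
    (μ : Measure Ω) (Y : Ω → G) (X : Ω → 𝒳) (φ : 𝒳 → F) (C : F →L[ℝ] G) : Prop :=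
  μ[Y | MeasurableSpace.comap X inferInstance] =ᵐ[μ] fun ω => C (φ (X ω))

section Estimator

variable {F G : Type*} [NormedAddCommGroup F] [InnerProductSpace ℝ F]
  [NormedAddCommGroup G] [InnerProductSpace ℝ G]

/-- The empirical (uncentered) cross-covariance operator `(1/T) ∑_{t < T} y_t ⊗ x_t`, where
`y ⊗ x` is the rank one operator `f ↦ ⟪x, f⟫ y`. -/
def empCov (T : ℕ) (y : ℕ → G) (x : ℕ → F) : F →L[ℝ] G :=
  (T : ℝ)⁻¹ • ∑ t ∈ Finset.range T, InnerProductSpace.rankOne ℝ (y t) (x t)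

/-- The regularized estimator `Ĉ_{YX} (Ĉ_{XX} + lam I)⁻¹` from the first `T` samples. For `lam > 0`
the operator `Ĉ_{XX} + lam I` on a Hilbert space is invertible, so that `Ring.inverse` is its
inverse. -/
def empOperator (lam : ℝ) (T : ℕ) (y : ℕ → G) (x : ℕ → F) : F →L[ℝ] G :=
  empCov T y x ∘L Ring.inverse (empCov T x x + lam • ContinuousLinearMap.id ℝ F)

end Estimator

/-! ### The interaction graph -/

/-- The inclusive neighbourhood `{j | e i j = 1} ∪ {i}` for a binary adjacency matrix `e`. -/
def nbhd {N : ℕ} (e : Fin N → Fin N → Bool) (i : Fin N) : Finset (Fin N) :=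
  Finset.univ.filter (fun j => e i j = true) ∪ {i}

section Prediction

variable {N : ℕ} {Act His : Fin N → Type*} (HA HS : Fin N → Type*) {G : Type*}
  [∀ j, NormedAddCommGroup (HA j)] [∀ j, InnerProductSpace ℝ (HA j)] [∀ j, CompleteSpace (HA j)]
  [∀ j, RKHS ℝ (HA j) (Act j) ℝ]
  [∀ j, NormedAddCommGroup (HS j)] [∀ j, InnerProductSpace ℝ (HS j)] [∀ j, CompleteSpace (HS j)]
  [∀ j, RKHS ℝ (HS j) (His j) ℝ]
  [NormedAddCommGroup G] [InnerProductSpace ℝ G]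

/-- `∑_{j ∈ E(i)} C_j [ψ^{h,j} ⊗ ψ^{a,j}]` at the input `x = (a^j, h^j)_j`. -/
def neighbourSum (e : Fin N → Fin N → Bool) (i : Fin N)
    (C : ∀ j, HilbertTensor (HS j) (HA j) →L[ℝ] G) (x : ∀ j, Act j × His j) : G :=
  ∑ j ∈ nbhd e i, C j (tensorFeature (HA j) (HS j) (x j))

/-- The estimated embedding `ψ̂^{O,i} = ∑_{j ∈ E(i)} Ĉ_{O^i|A^jH^j} [ψ^{h,j} ⊗ ψ^{a,j}]` at the
input `x`, from the first `T` of the samples with inputs `inp t` and responses `resp t j`. -/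
def estEmbedding (e : Fin N → Fin N → Bool) (i : Fin N) (lam : ℝ) (T : ℕ)
    (inp : ℕ → ∀ j, Act j × His j) (resp : ℕ → Fin N → G) (x : ∀ j, Act j × His j) : G :=
  neighbourSum HA HS e i
    (fun j => empOperator lam T (fun t => resp t j)
      (fun t => tensorFeature (HA j) (HS j) (inp t j))) x

end Prediction

end

end GCE

/-!
The estimator is a kernel ridge regression, and its error at `f = φ(x)` splits as follows. Let `z_t`
be the tensor features, `ε_t = y_t - C z_t` the residuals, `Ĉ = (1/T) ∑ z_t ⊗ z_t`, and
`u = (Ĉ + lam I)⁻¹ f`. Then the error is the noise `(1/T) ∑ ⟪z_t, u⟫ ε_t` minus the bias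
`C (lam u)` (`empOperator_apply_sub`). Everything is driven by the energy identity
`(1/T) ∑ ⟪z_t, u⟫² + lam ‖u‖² = ⟪f, u⟫` (`energy_resolvent`).

*Noise* (`tendstoInMeasure_noise`). The weights `⟪z_t, u⟫` are functions of the inputs only, and
the residuals are independent and centered given the inputs. Hence the mixed terms of the second
moment vanish, although each weight depends on all inputs (`integral_norm_sum_residual_sq_le`).
The energy identity bounds `∑ ⟪z_t, u⟫²` by `T ‖f‖² / lam`, so the second moment of the noise is of
order `1 / (T lam)`. This is why `T lam → ∞` suffices: an operator norm bound for the noise would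
need `T lam² → ∞`.

*Bias* (`tendstoInMeasure_bias`). As `x` lies in the support of the input law, the law of large
numbers puts a nonvanishing fraction `p` of the features `z_t` within `ε` of `f`. Averaging `⟪f, u⟫`
over these `t` and using Young's inequality, the energy identity gives
`(lam ‖u‖)² ≤ ε (lam ‖u‖) + lam / (4 p)`, so that `lam ‖u‖` is eventually at most `2 ε`
(`norm_smul_resolvent_le`). No population covariance operator is needed.

Measurability is unproblematic because a continuous characteristic kernel on a compact space makes
the space metrizable (`isClosedEmbedding_featureMap`) and the Hilbert space separable
(`secondCountableTopology_of_continuous_featureMap`).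

For the induced distributions, the probability measures on a compact Hausdorff space form a compact
space, on which the distance of the kernel mean to a given vector is lower semicontinuous; so a
minimizer exists (`exists_isInducedBy`), and its discrepancy to the true conditional law is at most
twice the error of the estimated embedding (`IsInducedBy.mmd_le`). The kernel mean, regarded as a
function on the observation space, embeds this compact space into a product of lines, so that small
discrepancy forces closeness in distribution (`exists_pos_forall_mmd_lt`).
-/

namespace GCE

open InnerProductSpace

/-! ### The regularized empirical operator -/

section Resolvent

variable {F G : Type*} [NormedAddCommGroup F] [InnerProductSpace ℝ F]
  [NormedAddCommGroup G] [InnerProductSpace ℝ G]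

lemma empCov_apply (T : ℕ) (y : ℕ → G) (z : ℕ → F) (u : F) :
    empCov T y z u = (T : ℝ)⁻¹ • ∑ t ∈ Finset.range T, (inner ℝ (z t) u) • y t := by
  simp [empCov]

lemma inner_empCov_self (T : ℕ) (z : ℕ → F) (u : F) :
    inner ℝ (empCov T z z u) u = (T : ℝ)⁻¹ * ∑ t ∈ Finset.range T, (inner ℝ (z t) u) ^ 2 := by
  simp [empCov_apply, inner_smul_left, sum_inner, pow_two]

/-- The regularized covariance `Ĉ_{XX} + lam I`. -/
noncomputable def regCov (lam : ℝ) (T : ℕ) (z : ℕ → F) : F →L[ℝ] F :=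
  empCov T z z + lam • ContinuousLinearMap.id ℝ F

/-- The vector `(Ĉ_{XX} + lam I)⁻¹ f`. For `lam > 0` the operator is invertible
(`isUnit_regCov`); otherwise `Ring.inverse` may take its junk value `0`. -/
noncomputable def resolvent (lam : ℝ) (T : ℕ) (z : ℕ → F) (f : F) : F :=
  Ring.inverse (regCov lam T z) f

lemma isUnit_regCov [CompleteSpace F] {lam : ℝ} (hlam : 0 < lam) (T : ℕ) (z : ℕ → F) :
    IsUnit (regCov lam T z) := by
  refine ContinuousLinearMap.isUnit_of_forall_le_norm_inner_map _ (c := lam.toNNReal)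
    (Real.toNNReal_pos.2 hlam) fun u ↦ ?_
  have h0 : 0 ≤ (T : ℝ)⁻¹ * ∑ t ∈ Finset.range T, (inner ℝ (z t) u) ^ 2 := by positivity
  have h1 : inner ℝ (regCov lam T z u) u
      = (T : ℝ)⁻¹ * ∑ t ∈ Finset.range T, (inner ℝ (z t) u) ^ 2 + lam * ‖u‖ ^ 2 := by
    simp [regCov, inner_add_left, inner_empCov_self, inner_smul_left]
  rw [h1, Real.norm_of_nonneg (by positivity)]
  rw [Real.coe_toNNReal _ hlam.le]
  linarith

lemma regCov_resolvent [CompleteSpace F] {lam : ℝ} (hlam : 0 < lam) (T : ℕ) (z : ℕ → F) (f : F) :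
    empCov T z z (resolvent lam T z f) + lam • resolvent lam T z f = f := by
  have h := Ring.mul_inverse_cancel _ (isUnit_regCov hlam T z)
  simpa [regCov, resolvent] using congrArg (fun A : F →L[ℝ] F ↦ A f) h

/-- The energy identity: pairing `(Ĉ_{XX} + lam I) u = f` with `u`. -/
lemma energy_resolvent [CompleteSpace F] {lam : ℝ} (hlam : 0 < lam) (T : ℕ) (z : ℕ → F) (f : F) :
    (T : ℝ)⁻¹ * ∑ t ∈ Finset.range T, (inner ℝ (z t) (resolvent lam T z f)) ^ 2
      + lam * ‖resolvent lam T z f‖ ^ 2 = inner ℝ f (resolvent lam T z f) := by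
  have h := congrArg (fun v ↦ inner ℝ v (resolvent lam T z f)) (regCov_resolvent hlam T z f)
  simpa [inner_add_left, inner_empCov_self, inner_smul_left, real_inner_self_eq_norm_sq] using h

lemma norm_resolvent_le [CompleteSpace F] {lam : ℝ} (hlam : 0 < lam) (T : ℕ) (z : ℕ → F) (f : F) :
    lam * ‖resolvent lam T z f‖ ≤ ‖f‖ := by
  have h := energy_resolvent hlam T z f
  have h0 : 0 ≤ (T : ℝ)⁻¹ * ∑ t ∈ Finset.range T,
    (inner ℝ (z t) (resolvent lam T z f)) ^ 2 := by positivity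
  have h1 := real_inner_le_norm f (resolvent lam T z f)
  rcases (norm_nonneg (resolvent lam T z f)).eq_or_lt with h2 | h2
  · rw [← h2]; simp
  · refine le_of_mul_le_mul_right ?_ h2
    nlinarith

/-- The weights of the noise term have a square sum of order `T / lam`, where the operator norm
of the resolvent would only give `T / lam ^ 2`. -/
lemma sum_inner_resolvent_sq_le [CompleteSpace F] {lam : ℝ} (hlam : 0 < lam) {T : ℕ} (hT : 0 < T)
    (z : ℕ → F) (f : F) :
    ∑ t ∈ Finset.range T, (inner ℝ (z t) (resolvent lam T z f)) ^ 2 ≤ T * (‖f‖ ^ 2 / lam) := by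
  have hT' : (0 : ℝ) < T := by exact_mod_cast hT
  have h := energy_resolvent hlam T z f
  have h1 := real_inner_le_norm f (resolvent lam T z f)
  have h2 := norm_resolvent_le hlam T z f
  have h3 : 0 ≤ lam * ‖resolvent lam T z f‖ ^ 2 := by positivity
  have h4 : ‖f‖ * ‖resolvent lam T z f‖ ≤ ‖f‖ ^ 2 / lam := by
    rw [le_div_iff₀ hlam]
    nlinarith [norm_nonneg f]
  rw [← inv_mul_le_iff₀ hT']
  linarith

/-- The regularization bias at `f` is small as soon as a nonvanishing fraction of the features
`z t` is close to `f`. -/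
lemma norm_smul_resolvent_le [CompleteSpace F] {lam : ℝ} (hlam : 0 < lam) {T : ℕ} (z : ℕ → F)
    (f : F) {ε : ℝ} (hε : 0 < ε) {S : Finset ℕ} (hS : S ⊆ Finset.range T)
    (hzS : ∀ t ∈ S, ‖f - z t‖ ≤ ε) {p : ℝ} (hp : 0 < p) (hpS : p * T ≤ S.card)
    (hpos : 0 < T) (hsmall : lam ≤ p * ε ^ 2) :
    lam * ‖resolvent lam T z f‖ ≤ 2 * ε := by
  have hT : (0 : ℝ) < T := by exact_mod_cast hpos
  have hcard : (0 : ℝ) < S.card := lt_of_lt_of_le (by positivity) hpS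
  set u := resolvent lam T z f with hu
  set q := (T : ℝ)⁻¹ * ∑ t ∈ Finset.range T, (inner ℝ (z t) u) ^ 2 with hq
  have henergy : q + lam * ‖u‖ ^ 2 = inner ℝ f u := energy_resolvent hlam T z f
  -- Young's inequality, with the weight for which the quadratic terms add up to at most `q`
  have hyoung : ∀ t ∈ S, inner ℝ f u ≤
      ε * ‖u‖ + (S.card / T * (inner ℝ (z t) u) ^ 2 + T / (4 * S.card)) := by
    intro t ht
    have h1 : inner ℝ (f - z t) u ≤ ε * ‖u‖ :=
      (real_inner_le_norm _ _).trans (by gcongr; exact hzS t ht)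
    have h2 : inner ℝ (z t) u ≤ S.card / T * (inner ℝ (z t) u) ^ 2 + T / (4 * S.card) := by
      have h3 : S.card / T * (inner ℝ (z t) u) ^ 2 + T / (4 * S.card) - inner ℝ (z t) u
          = S.card / T * (inner ℝ (z t) u - T / (2 * S.card)) ^ 2 := by
        field_simp
        ring
      have h4 : 0 ≤ S.card / T * (inner ℝ (z t) u - T / (2 * S.card)) ^ 2 := by positivity
      linarith
    rw [inner_sub_left] at h1
    linarith
  have hsum : (S.card : ℝ) * inner ℝ f u ≤
      S.card * (ε * ‖u‖ + q + T / (4 * S.card)) := by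
    have h1 := Finset.sum_le_sum hyoung
    have h2 : ∑ t ∈ S, (inner ℝ (z t) u) ^ 2 ≤ ∑ t ∈ Finset.range T, (inner ℝ (z t) u) ^ 2 :=
      Finset.sum_le_sum_of_subset_of_nonneg hS fun _ _ _ ↦ sq_nonneg _
    simp only [Finset.sum_const, nsmul_eq_mul, Finset.sum_add_distrib, ← Finset.mul_sum] at h1
    have h3 : (S.card / T : ℝ) * ∑ t ∈ S, (inner ℝ (z t) u) ^ 2 ≤ S.card * q := by
      rw [hq, div_eq_mul_inv, mul_assoc]
      gcongr
    linarith
  have hmain : lam * ‖u‖ ^ 2 ≤ ε * ‖u‖ + T / (4 * S.card) := by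
    have := le_of_mul_le_mul_left hsum hcard
    linarith
  have hfrac : lam * (T / (4 * S.card)) ≤ ε ^ 2 := by
    rw [← mul_div_assoc, div_le_iff₀ (by positivity)]
    nlinarith [mul_le_mul_of_nonneg_right hsmall hT.le, mul_le_mul_of_nonneg_left hpS (sq_nonneg ε)]
  have hquad : (lam * ‖u‖) ^ 2 ≤ ε * (lam * ‖u‖) + ε ^ 2 := by
    nlinarith [mul_le_mul_of_nonneg_left hmain hlam.le]
  by_contra hcon
  nlinarith

/-- The error of the estimator splits into a noise term, linear in the residuals
`y t - C (z t)`, and the regularization bias. -/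
lemma empOperator_apply_sub [CompleteSpace F] {lam : ℝ} (hlam : 0 < lam) (T : ℕ) (y : ℕ → G)
    (z : ℕ → F) (C : F →L[ℝ] G) (f : F) :
    empOperator lam T y z f - C f =
      (T : ℝ)⁻¹ • ∑ t ∈ Finset.range T, (inner ℝ (z t) (resolvent lam T z f)) • (y t - C (z t))
        - C (lam • resolvent lam T z f) := by
  have h1 : empOperator lam T y z f = empCov T y z (resolvent lam T z f) := rfl
  have h2 : C f = C (empCov T z z (resolvent lam T z f)) + C (lam • resolvent lam T z f) := by
    rw [← map_add, regCov_resolvent hlam]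
  rw [h1, h2, empCov_apply, empCov_apply]
  simp only [map_smul, map_sum, smul_sub, Finset.sum_sub_distrib]
  abel

/-- In terms of the inputs `p t`, the resolvent is continuous for the product topology. It is
through this continuity that the weights of the noise term are measurable. -/
lemma continuous_resolvent [CompleteSpace F] {𝒳 : Type*} [TopologicalSpace 𝒳] {φ : 𝒳 → F}
    (hφ : Continuous φ) {lam : ℝ} (hlam : 0 < lam) (T : ℕ) (f : F) :
    Continuous fun p : ℕ → 𝒳 ↦ resolvent lam T (fun t ↦ φ (p t)) f := by
  have h1 : Continuous fun p : ℕ → 𝒳 ↦ regCov lam T (fun t ↦ φ (p t)) := by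
    unfold regCov empCov
    have h2 : ∀ t, Continuous fun p : ℕ → 𝒳 ↦ rankOne ℝ (φ (p t)) (φ (p t)) := fun t ↦
      ((rankOne ℝ).continuous.comp (hφ.comp (continuous_apply t))).clm_apply
        (hφ.comp (continuous_apply t))
    have h3 := continuous_finsetSum (Finset.range T) fun t _ ↦ h2 t
    exact (h3.const_smul ((T : ℝ)⁻¹)).add continuous_const
  have h2 : Continuous fun p : ℕ → 𝒳 ↦ Ring.inverse (regCov lam T (fun t ↦ φ (p t))) := by
    refine continuous_iff_continuousAt.2 fun p ↦ ?_
    obtain ⟨v, hv⟩ := isUnit_regCov hlam T (fun t ↦ φ (p t))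
    have h3 := NormedRing.inverse_continuousAt v
    rw [hv] at h3
    exact ContinuousAt.comp (f := fun p : ℕ → 𝒳 ↦ regCov lam T (fun t ↦ φ (p t))) h3
      h1.continuousAt
  exact h2.clm_apply continuous_const

lemma resolvent_congr {lam : ℝ} {T : ℕ} {z z' : ℕ → F} (h : ∀ t ∈ Finset.range T, z t = z' t)
    (f : F) : resolvent lam T z f = resolvent lam T z' f := by
  have : empCov T z z = empCov T z' z' := by
    unfold empCov
    rw [Finset.sum_congr rfl fun t ht ↦ by rw [h t ht]]
  simp only [resolvent, regCov, this]

end Resolvent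

/-! ### Convergence in measure -/

section InMeasure

variable {Ω ι E : Type*} [MeasurableSpace Ω] {μ : Measure Ω} [IsFiniteMeasure μ]
  [SeminormedAddCommGroup E] {l : Filter ι}

lemma tendstoInMeasure_zero_iff {a : ι → Ω → E} :
    TendstoInMeasure μ a l (fun _ ↦ 0) ↔
      ∀ ε, 0 < ε → Tendsto (fun T ↦ μ.real {ω | ε ≤ ‖a T ω‖}) l (𝓝 0) := by
  simp [tendstoInMeasure_iff_measureReal_norm]

/-- Pointwise domination transfers convergence to zero in measure; the dominated family `b` need not
be measurable. -/
lemma tendstoInMeasure_zero_of_imp {E' : Type*} [SeminormedAddCommGroup E'] {a : ι → Ω → E}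
    {b : ι → Ω → E'} (ha : TendstoInMeasure μ a l (fun _ ↦ 0))
    (h : ∀ ε, 0 < ε → ∃ δ, 0 < δ ∧ ∀ᶠ T in l, ∀ ω, ‖a T ω‖ < δ → ‖b T ω‖ < ε) :
    TendstoInMeasure μ b l (fun _ ↦ 0) := by
  rw [tendstoInMeasure_zero_iff] at ha ⊢
  intro ε hε
  obtain ⟨δ, hδ, hT⟩ := h ε hε
  refine squeeze_zero' (.of_forall fun _ ↦ measureReal_nonneg) ?_ (ha δ hδ)
  filter_upwards [hT] with T hT
  refine measureReal_mono fun ω hω ↦ ?_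
  by_contra hcon
  exact absurd (hT ω (not_le.1 hcon)) (not_lt.2 hω)

lemma tendstoInMeasure_zero_add {a b : ι → Ω → E} (ha : TendstoInMeasure μ a l (fun _ ↦ 0))
    (hb : TendstoInMeasure μ b l (fun _ ↦ 0)) :
    TendstoInMeasure μ (fun T ω ↦ a T ω + b T ω) l (fun _ ↦ 0) := by
  rw [tendstoInMeasure_zero_iff] at ha hb ⊢
  intro ε hε
  have h := (ha (ε / 2) (half_pos hε)).add (hb (ε / 2) (half_pos hε))
  rw [add_zero] at h
  refine squeeze_zero (fun _ ↦ measureReal_nonneg) (fun T ↦ ?_) h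
  refine (measureReal_mono fun ω hω ↦ ?_).trans (measureReal_union_le _ _)
  by_contra hcon
  simp only [Set.mem_union, Set.mem_ofPred_eq, not_or, not_le] at hcon hω
  linarith [norm_add_le (a T ω) (b T ω)]

lemma tendstoInMeasure_zero_sum {J : Type*} (s : Finset J) {a : J → ι → Ω → E}
    (ha : ∀ j ∈ s, TendstoInMeasure μ (a j) l (fun _ ↦ 0)) :
    TendstoInMeasure μ (fun T ω ↦ ∑ j ∈ s, a j T ω) l (fun _ ↦ 0) := by
  classical
  induction s using Finset.induction_on with
  | empty =>
    rw [tendstoInMeasure_zero_iff]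
    intro ε hε
    simpa [not_le.2 hε] using tendsto_const_nhds
  | insert j s hj ih =>
    simp only [Finset.sum_insert hj]
    exact tendstoInMeasure_zero_add (ha j (Finset.mem_insert_self j s))
      (ih fun k hk ↦ ha k (Finset.mem_insert_of_mem hk))

end InMeasure

/-! ### Independent samples -/

section Sampling

variable {Ω : Type*} [MeasurableSpace Ω] {μ : Measure Ω} [IsProbabilityMeasure μ]

/-- A function of finitely many independent samples has mean zero if integrating out one of the
samples, with the others frozen, always gives zero. -/
lemma integral_eq_zero_of_integral_update_eq_zero {E : Type*} [MeasurableSpace E]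
    {Z : ℕ → Ω → E} (hZ : ∀ k, Measurable (Z k)) (hind : iIndepFun Z μ)
    {f : (ℕ → E) → ℝ} (hf : Measurable f) {S : Finset ℕ}
    (hdep : ∀ p q, (∀ k ∈ S, p k = q k) → f p = f q) {t : ℕ}
    (hint : Integrable (fun ω ↦ f fun k ↦ Z k ω) μ)
    (h0 : ∀ p, ∫ e, f (Function.update p t e) ∂(μ.map (Z t)) = 0) :
    ∫ ω, f (fun k ↦ Z k ω) ∂μ = 0 := by
  classical
  obtain ⟨ω₀⟩ : Nonempty Ω := nonempty_of_isProbabilityMeasure μ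
  -- `g` completes the samples other than `t` to a full sequence; values outside `S` do not matter
  let g : (S.erase t → E) → ℕ → E := fun r k ↦ if h : k ∈ S.erase t then r ⟨k, h⟩ else Z k ω₀
  have hg : Measurable g := by
    refine measurable_pi_lambda _ fun k ↦ ?_
    by_cases h : k ∈ S.erase t
    · simp only [g, dif_pos h]
      exact measurable_pi_apply (⟨k, h⟩ : S.erase t)
    · simp only [g, dif_neg h]
      exact measurable_const
  let R : Ω → S.erase t → E := fun ω k ↦ Z k ω
  have hR : Measurable R := measurable_pi_lambda _ fun k ↦ hZ k
  have hRZ : IndepFun R (Z t) μ :=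
    ((hind.indepFun_finset (S.erase t) {t} (by simp) hZ).comp measurable_id
      (measurable_pi_apply (⟨t, by simp⟩ : ({t} : Finset ℕ))))
  have hlaw := (indepFun_iff_map_prod_eq_prod_map_map hR.aemeasurable (hZ t).aemeasurable).1 hRZ
  let F : (S.erase t → E) × E → ℝ := fun x ↦ f (Function.update (g x.1) t x.2)
  have hF : Measurable F :=
    hf.comp (measurable_update'.comp ((hg.comp measurable_fst).prodMk measurable_snd))
  have hfF : (fun ω ↦ f fun k ↦ Z k ω) = fun ω ↦ F (R ω, Z t ω) := by
    funext ω
    refine hdep _ _ fun k hk ↦ ?_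
    by_cases hkt : k = t
    · subst hkt; simp
    · simp [g, R, hkt, hk]
  have hRZm : Measurable fun ω ↦ (R ω, Z t ω) := hR.prodMk (hZ t)
  have hFint : Integrable F ((μ.map R).prod (μ.map (Z t))) := by
    rw [← hlaw, integrable_map_measure hF.aestronglyMeasurable hRZm.aemeasurable]
    rw [hfF] at hint
    exact hint
  have := Measure.isProbabilityMeasure_map (μ := μ) (hZ t).aemeasurable
  rw [hfF, ← integral_map hRZm.aemeasurable hF.aestronglyMeasurable, hlaw, integral_prod _ hFint]
  simp [F, h0]

variable {𝒳 G : Type*} [MeasurableSpace 𝒳] [NormedAddCommGroup G] [InnerProductSpace ℝ G]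
  [CompleteSpace G]
  [MeasurableSpace G] [BorelSpace G] [SecondCountableTopology G]

/-- Let the residuals `r (Z s)` have mean zero conditionally on the inputs `(Z s).1`. For weights
that depend on all the inputs, but not on the responses, the residuals are still orthogonal, so
that the second moment of the weighted sum is the sum of the second moments. -/
lemma integral_norm_sum_residual_sq_le {Z : ℕ → Ω → 𝒳 × G} (hZ : ∀ k, Measurable (Z k))
    (hind : iIndepFun Z μ) {ρ : Measure (𝒳 × G)} (hρ : ∀ k, μ.map (Z k) = ρ)
    {r : 𝒳 × G → G} (hr : Measurable r) {D : ℝ} (hrD : ∀ᵐ e ∂ρ, ‖r e‖ ≤ D)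
    (hr0 : ∀ W : 𝒳 → ℝ, Measurable W → (∃ b, ∀ x, |W x| ≤ b) → ∫ e, W e.1 • r e ∂ρ = 0)
    {T : ℕ} {w : ℕ → (ℕ → 𝒳) → ℝ} (hw : ∀ s, Measurable (w s)) {b : ℝ}
    (hwb : ∀ s p, |w s p| ≤ b)
    (hdep : ∀ s ∈ Finset.range T, ∀ p q, (∀ k ∈ Finset.range T, p k = q k) → w s p = w s q)
    {c : ℝ} (hc : ∀ p, ∑ s ∈ Finset.range T, w s p ^ 2 ≤ c) :
    Integrable (fun ω ↦ ‖∑ s ∈ Finset.range T, w s (fun k ↦ (Z k ω).1) • r (Z s ω)‖ ^ 2) μ ∧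
    ∫ ω, ‖∑ s ∈ Finset.range T, w s (fun k ↦ (Z k ω).1) • r (Z s ω)‖ ^ 2 ∂μ ≤ D ^ 2 * c := by
  have : IsProbabilityMeasure ρ := by
    rw [← hρ 0]; exact Measure.isProbabilityMeasure_map (hZ 0).aemeasurable
  have hrDω : ∀ᵐ ω ∂μ, ∀ k, ‖r (Z k ω)‖ ≤ D := by
    refine ae_all_iff.2 fun k ↦ ?_
    have h := hrD
    rw [← hρ k] at h
    exact ae_of_ae_map (hZ k).aemeasurable h
  have hD : 0 ≤ D := by
    obtain ⟨ω, hω⟩ := hrDω.exists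
    exact (norm_nonneg _).trans (hω 0)
  have hb : 0 ≤ b := by
    obtain ⟨ω, hω⟩ := hrDω.exists
    exact (abs_nonneg _).trans (hwb 0 fun k ↦ (Z k ω).1)
  -- the summands of the expanded square, as functions of the whole sample
  let f : ℕ → ℕ → (ℕ → 𝒳 × G) → ℝ := fun s t p ↦
    inner ℝ (w s (fun k ↦ (p k).1) • r (p s)) (w t (fun k ↦ (p k).1) • r (p t))
  have hw' : ∀ s, Measurable fun p : ℕ → 𝒳 × G ↦ w s (fun k ↦ (p k).1) := fun s ↦
    (hw s).comp (measurable_pi_lambda _ fun k ↦ measurable_fst.comp (measurable_pi_apply k))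
  have hv : ∀ s, Measurable fun p : ℕ → 𝒳 × G ↦ w s (fun k ↦ (p k).1) • r (p s) := fun s ↦
    (hw' s).smul (hr.comp (measurable_pi_apply s))
  have hf : ∀ s t, Measurable (f s t) := fun s t ↦ (hv s).inner (hv t)
  have hZm : Measurable fun ω k ↦ Z k ω := measurable_pi_lambda _ hZ
  have hfint : ∀ s t, Integrable (fun ω ↦ f s t fun k ↦ Z k ω) μ := by
    intro s t
    refine Integrable.of_bound ((hf s t).comp hZm).aestronglyMeasurable ((b * D) * (b * D)) ?_
    filter_upwards [hrDω] with ω hω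
    refine (norm_inner_le_norm _ _).trans ?_
    rw [norm_smul, norm_smul, Real.norm_eq_abs, Real.norm_eq_abs]
    gcongr
    exacts [hwb _ _, hω s, hwb _ _, hω t]
  have hcross : ∀ s ∈ Finset.range T, ∀ t ∈ Finset.range T, s ≠ t →
      ∫ ω, f s t (fun k ↦ Z k ω) ∂μ = 0 := by
    intro s hs t ht hst
    refine integral_eq_zero_of_integral_update_eq_zero hZ hind (hf s t) (S := Finset.range T)
      (t := t) (fun p q hpq ↦ ?_) (hfint s t) fun p ↦ ?_
    · simp only [f]
      rw [hdep s hs _ (fun k ↦ (q k).1) fun k hk ↦ by rw [hpq k hk],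
        hdep t ht _ (fun k ↦ (q k).1) fun k hk ↦ by rw [hpq k hk], hpq s hs, hpq t ht]
    · have hup : ∀ e : 𝒳 × G, (fun k ↦ (Function.update p t e k).1)
          = Function.update (fun k ↦ (p k).1) t e.1 := fun e ↦ by
        funext k
        by_cases hk : k = t
        · subst hk; simp
        · simp [Function.update_of_ne hk]
      -- with the other samples frozen, the product of the two weights is a function of one input
      let W : 𝒳 → ℝ := fun x ↦ w s (Function.update (fun k ↦ (p k).1) t x) *
        w t (Function.update (fun k ↦ (p k).1) t x)
      have hW : Measurable W :=
        ((hw s).comp (measurable_update _)).mul ((hw t).comp (measurable_update _))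
      have hWb : ∀ x, |W x| ≤ b * b := fun x ↦ by
        rw [abs_mul]
        gcongr <;> exact hwb _ _
      have hWint : Integrable (fun e : 𝒳 × G ↦ W e.1 • r e) ρ := by
        refine Integrable.of_bound
          ((hW.comp measurable_fst).smul hr).aestronglyMeasurable (b * b * D) ?_
        filter_upwards [hrD] with e he
        rw [norm_smul, Real.norm_eq_abs]
        gcongr
        exact hWb _
      have hfW : ∀ e, f s t (Function.update p t e) = inner ℝ (r (p s)) (W e.1 • r e) := fun e ↦ by
        simp only [f, hup, Function.update_self, Function.update_of_ne hst, W, real_inner_smul_left,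
          real_inner_smul_right]
        ring
      simp_rw [hfW]
      rw [hρ t, integral_inner hWint, hr0 W hW ⟨_, hWb⟩, inner_zero_right]
  have hexp : ∀ ω, ‖∑ s ∈ Finset.range T, w s (fun k ↦ (Z k ω).1) • r (Z s ω)‖ ^ 2
      = ∑ s ∈ Finset.range T, ∑ t ∈ Finset.range T, f s t (fun k ↦ Z k ω) := fun ω ↦ by
    simp only [← real_inner_self_eq_norm_sq, sum_inner, inner_sum, f]
    exact Finset.sum_comm
  simp_rw [hexp]
  refine ⟨integrable_finsetSum _ fun s _ ↦ integrable_finsetSum _ fun t _ ↦ hfint s t, ?_⟩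
  rw [integral_finsetSum _ fun s _ ↦ integrable_finsetSum _ fun t _ ↦ hfint s t]
  have hdiag : ∀ s ∈ Finset.range T, ∫ ω, ∑ t ∈ Finset.range T, f s t (fun k ↦ Z k ω) ∂μ
      = ∫ ω, f s s (fun k ↦ Z k ω) ∂μ := by
    intro s hs
    rw [integral_finsetSum _ fun t _ ↦ hfint s t]
    exact Finset.sum_eq_single_of_mem s hs fun t ht hts ↦ hcross s hs t ht hts.symm
  rw [Finset.sum_congr rfl hdiag, ← integral_finsetSum _ fun s _ ↦ hfint s s]
  calc ∫ ω, ∑ s ∈ Finset.range T, f s s (fun k ↦ Z k ω) ∂μ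
      ≤ ∫ _, D ^ 2 * c ∂μ := by
        refine integral_mono_ae (integrable_finsetSum _ fun s _ ↦ hfint s s)
          (integrable_const _) ?_
        filter_upwards [hrDω] with ω hω
        refine le_trans ?_ (mul_le_mul_of_nonneg_left (hc fun k ↦ (Z k ω).1) (sq_nonneg D))
        rw [Finset.mul_sum]
        refine Finset.sum_le_sum fun s _ ↦ ?_
        simp only [f]
        rw [real_inner_self_eq_norm_sq, norm_smul, mul_pow, Real.norm_eq_abs, sq_abs, mul_comm]
        gcongr
        exact hω s
    _ = D ^ 2 * c := by simp

end Sampling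

/-! ### Consistency of the regularized operator regression -/

section Consistency

variable {Ω : Type*} [MeasurableSpace Ω] {μ : Measure Ω} [IsProbabilityMeasure μ]
  {𝒳 F G : Type*} [MeasurableSpace 𝒳] [NormedAddCommGroup F] [InnerProductSpace ℝ F]
  [NormedAddCommGroup G] [InnerProductSpace ℝ G] [CompleteSpace G]
  [MeasurableSpace G] [BorelSpace G] [SecondCountableTopology G]

/-- The residuals `Y - C (φ X)` of a conditional embedding operator are orthogonal to all bounded
functions of the input. -/
lemma integral_smul_residual_eq_zero {X : Ω → 𝒳} {Y : Ω → G} (hX : Measurable X)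
    (hY : Measurable Y) {B : ℝ} (hYB : ∀ᵐ ω ∂μ, ‖Y ω‖ ≤ B) {φ : 𝒳 → F} {C : F →L[ℝ] G}
    (hCφ : Measurable fun x ↦ C (φ x)) {D : ℝ} (hD : ∀ x, ‖C (φ x)‖ ≤ D)
    (hC : IsCondEmbeddingOperator μ Y X φ C) (W : 𝒳 → ℝ) (hW : Measurable W)
    (hWb : ∃ b, ∀ x, |W x| ≤ b) :
    ∫ e, W e.1 • (e.2 - C (φ e.1)) ∂(μ.map fun ω ↦ (X ω, Y ω)) = 0 := by
  obtain ⟨b, hb⟩ := hWb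
  have hYint : Integrable Y μ := Integrable.of_bound hY.aestronglyMeasurable B hYB
  have hWX : ∀ᵐ ω ∂μ, ‖(W ∘ X) ω‖ ≤ b := .of_forall fun ω ↦ hb _
  have hWm : AEStronglyMeasurable (W ∘ X) μ := (hW.comp hX).aestronglyMeasurable
  have hWY : Integrable ((W ∘ X) • Y) μ := hYint.bdd_smul b hWm hWX
  have hCint : Integrable (fun ω ↦ C (φ (X ω))) μ :=
    Integrable.of_bound (hCφ.comp hX).aestronglyMeasurable D (.of_forall fun ω ↦ hD _)
  have hWC : Integrable (fun ω ↦ W (X ω) • C (φ (X ω))) μ := hCint.bdd_smul b hWm hWX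
  have hm : MeasurableSpace.comap X inferInstance ≤ ‹MeasurableSpace Ω› := hX.comap_le
  have hpull := condExp_smul_of_aestronglyMeasurable_left (μ := μ)
    (m := MeasurableSpace.comap X inferInstance) (f := W ∘ X) (g := Y)
    (hW.comp (comap_measurable X)).stronglyMeasurable.aestronglyMeasurable hWY hYint
  have hcond : ∫ ω, W (X ω) • Y ω ∂μ = ∫ ω, W (X ω) • C (φ (X ω)) ∂μ := by
    refine (integral_condExp hm).symm.trans (integral_congr_ae ?_)
    refine hpull.trans ?_
    filter_upwards [hC] with ω hω
    simp [hω]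
  have hmeas : Measurable fun e : 𝒳 × G ↦ W e.1 • (e.2 - C (φ e.1)) :=
    (hW.comp measurable_fst).smul (measurable_snd.sub (hCφ.comp measurable_fst))
  rw [integral_map (hX.prodMk hY).aemeasurable hmeas.aestronglyMeasurable]
  simp only [smul_sub]
  exact (integral_sub hWY hWC).trans (sub_eq_zero.2 hcond)

variable [TopologicalSpace 𝒳] [BorelSpace 𝒳] [CompleteSpace F]

/-- The regularization bias at a point of the support of the input law vanishes: by the law of
large numbers a nonvanishing fraction of the inputs falls into any neighbourhood of the point. -/
lemma tendstoInMeasure_bias {X : ℕ → Ω → 𝒳} (hX : ∀ t, Measurable (X t))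
    (hind : iIndepFun X μ) (hident : ∀ t, IdentDistrib (X t) (X 0) μ μ)
    {φ : 𝒳 → F} (hφ : Continuous φ) {lam : ℕ → ℝ} (hlam : Tendsto lam atTop (𝓝 0))
    (hpos : ∀ᶠ T in atTop, 0 < lam T) {x : 𝒳} (hx : x ∈ (μ.map (X 0)).support) :
    TendstoInMeasure μ (fun T ω ↦ lam T • resolvent (lam T) T (fun s ↦ φ (X s ω)) (φ x)) atTop
      (fun _ ↦ 0) := by
  classical
  rw [tendstoInMeasure_zero_iff]
  intro ε hε
  set U : Set 𝒳 := {x' | ‖φ x - φ x'‖ < ε / 4} with hU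
  have hUo : IsOpen U := isOpen_lt (by fun_prop) continuous_const
  have hxU : x ∈ U := by simp [hU, hε]
  set q := (μ.map (X 0)).real U with hq
  have hq0 : 0 < q := by
    have h1 := (Measure.mem_support_iff_forall x).1 hx U (hUo.mem_nhds hxU)
    have := Measure.isProbabilityMeasure_map (μ := μ) (hX 0).aemeasurable
    exact ENNReal.toReal_pos h1.ne' (measure_ne_top _ _)
  -- the fraction of the first `T` inputs in `U`
  let I : 𝒳 → ℝ := U.indicator 1
  have hI : Measurable I := measurable_const.indicator hUo.measurableSet
  have hIX : ∀ t, Measurable fun ω ↦ I (X t ω) := fun t ↦ hI.comp (hX t)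
  have hslln := strong_law_ae_real (μ := μ) (fun t ω ↦ I (X t ω))
    (Integrable.of_bound (hIX 0).aestronglyMeasurable 1 (.of_forall fun ω ↦ by
      simp only [I, Set.indicator_apply, Pi.one_apply]
      split_ifs <;> simp))
    (fun s t hst ↦ (hind.indepFun hst).comp hI hI) (fun t ↦ (hident t).comp hI)
  have hmean : ∫ ω, I (X 0 ω) ∂μ = q := by
    rw [← integral_map (hX 0).aemeasurable hI.aestronglyMeasurable]
    exact integral_indicator_one hUo.measurableSet
  have hfreq : TendstoInMeasure μ (fun (T : ℕ) ω ↦ (∑ t ∈ Finset.range T, I (X t ω)) / (T : ℝ) - q)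
      atTop (fun _ ↦ 0) := by
    refine tendstoInMeasure_of_tendsto_ae (fun T ↦ ?_) ?_
    · exact ((Finset.measurable_fun_sum _ fun t _ ↦ hIX t).div_const _).sub_const _
        |>.aestronglyMeasurable
    · filter_upwards [hslln] with ω hω
      rw [hmean] at hω
      simpa using hω.sub_const q
  rw [tendstoInMeasure_zero_iff] at hfreq
  -- outside the event that the fraction deviates from `q` by `q / 2`, the bias is below `ε`
  refine squeeze_zero' (.of_forall fun _ ↦ measureReal_nonneg) ?_ (hfreq (q / 2) (half_pos hq0))
  have hsmall : ∀ᶠ T in atTop, lam T < q / 2 * (ε / 4) ^ 2 :=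
    hlam.eventually_lt_const (by positivity)
  filter_upwards [hpos, hsmall, eventually_gt_atTop 0] with T hl hs hT
  have hT' : (0 : ℝ) < T := by exact_mod_cast hT
  refine measureReal_mono fun ω hω ↦ ?_
  simp only [Set.mem_ofPred_eq] at hω ⊢
  by_contra hcon
  rw [not_le, Real.norm_eq_abs, abs_lt] at hcon
  have hcard : ∑ t ∈ Finset.range T, I (X t ω)
      = (((Finset.range T).filter fun t ↦ X t ω ∈ U).card : ℝ) := by
    simp [I, Set.indicator_apply]
  have hfrac : q / 2 * T ≤ (((Finset.range T).filter fun t ↦ X t ω ∈ U).card : ℝ) := by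
    rw [← hcard, ← le_div_iff₀ hT']
    linarith [hcon.1]
  have h := norm_smul_resolvent_le hl (fun s ↦ φ (X s ω)) (φ x) (ε := ε / 4) (by positivity)
    (Finset.filter_subset (fun t ↦ X t ω ∈ U) (Finset.range T))
    (fun t ht ↦ (Finset.mem_filter.1 ht).2.le) (half_pos hq0) hfrac hT hs.le
  rw [norm_smul, Real.norm_of_nonneg hl.le] at hω
  linarith

variable [SecondCountableTopology 𝒳]

/-- The noise term of the estimator vanishes: its second moment is at most of the order
`1 / (T * lam T)`. -/
lemma tendstoInMeasure_noise {X : ℕ → Ω → 𝒳} {Y : ℕ → Ω → G}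
    (hX : ∀ t, Measurable (X t)) (hY : ∀ t, Measurable (Y t))
    (hind : iIndepFun (fun t ω ↦ (X t ω, Y t ω)) μ)
    (hident : ∀ t, IdentDistrib (fun ω ↦ (X t ω, Y t ω)) (fun ω ↦ (X 0 ω, Y 0 ω)) μ μ)
    {B : ℝ} (hYB : ∀ᵐ ω ∂μ, ‖Y 0 ω‖ ≤ B) {φ : 𝒳 → F} (hφ : Continuous φ) {K : ℝ}
    (hK : ∀ x, ‖φ x‖ ≤ K) {C : F →L[ℝ] G} (hC : IsCondEmbeddingOperator μ (Y 0) (X 0) φ C)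
    {lam : ℕ → ℝ} (hTlam : Tendsto (fun T : ℕ ↦ (T : ℝ) * lam T) atTop atTop) (f : F) :
    TendstoInMeasure μ (fun (T : ℕ) ω ↦ (T : ℝ)⁻¹ • ∑ t ∈ Finset.range T,
      (inner ℝ (φ (X t ω)) (resolvent (lam T) T (fun s ↦ φ (X s ω)) f)) •
        (Y t ω - C (φ (X t ω)))) atTop (fun _ ↦ 0) := by
  set D := B + ‖C‖ * K with hDdef
  have hCK : ∀ x, ‖C (φ x)‖ ≤ ‖C‖ * K := fun x ↦
    (C.le_opNorm _).trans (mul_le_mul_of_nonneg_left (hK x) (norm_nonneg _))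
  have hCφ : Measurable fun x ↦ C (φ x) := (C.continuous.comp hφ).measurable
  have hr : Measurable fun e : 𝒳 × G ↦ e.2 - C (φ e.1) :=
    measurable_snd.sub (hCφ.comp measurable_fst)
  have hrD : ∀ᵐ e ∂(μ.map fun ω ↦ (X 0 ω, Y 0 ω)), ‖e.2 - C (φ e.1)‖ ≤ D := by
    refine (ae_map_iff ((hX 0).prodMk (hY 0)).aemeasurable
      (measurableSet_le hr.norm measurable_const)).2 ?_
    filter_upwards [hYB] with ω hω
    exact (norm_sub_le _ _).trans (add_le_add hω (hCK _))
  have hbound : ∀ T : ℕ, 0 < T → 0 < lam T → ∀ ε, 0 < ε →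
      μ.real {ω | ε ≤ ‖(T : ℝ)⁻¹ • ∑ t ∈ Finset.range T,
        (inner ℝ (φ (X t ω)) (resolvent (lam T) T (fun s ↦ φ (X s ω)) f)) •
          (Y t ω - C (φ (X t ω)))‖} ≤ (D ^ 2 * ‖f‖ ^ 2 / ε ^ 2) * ((T : ℝ) * lam T)⁻¹ := by
    intro T hT hl ε hε
    have hT' : (0 : ℝ) < T := by exact_mod_cast hT
    have hcont : ∀ s, Continuous fun p : ℕ → 𝒳 ↦
        inner ℝ (φ (p s)) (resolvent (lam T) T (fun t ↦ φ (p t)) f) := fun s ↦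
      (hφ.comp (continuous_apply s)).inner (continuous_resolvent hφ hl T f)
    obtain ⟨hint, hle⟩ := integral_norm_sum_residual_sq_le
      (fun k ↦ (hX k).prodMk (hY k)) hind (fun k ↦ (hident k).map_eq) hr hrD
      (integral_smul_residual_eq_zero (hX 0) (hY 0) hYB hCφ hCK hC) (T := T)
      (w := fun s p ↦ inner ℝ (φ (p s)) (resolvent (lam T) T (fun t ↦ φ (p t)) f))
      (fun s ↦ (hcont s).measurable) (b := K * (‖f‖ / lam T))
      (fun s p ↦ by
        refine (abs_real_inner_le_norm _ _).trans ?_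
        refine mul_le_mul (hK _) ?_ (norm_nonneg _) ((norm_nonneg _).trans (hK (p s)))
        rw [le_div_iff₀' hl]
        exact norm_resolvent_le hl T _ f)
      (fun s hs p q hpq ↦ by
        simp only [hpq s hs]
        rw [resolvent_congr fun t ht ↦ by rw [hpq t ht]])
      (fun p ↦ sum_inner_resolvent_sq_le hl hT _ f)
    have hmarkov := mul_meas_ge_le_integral_of_nonneg (.of_forall fun ω ↦ by positivity) hint
      ((T * ε) ^ 2)
    have hset : {ω | ε ≤ ‖(T : ℝ)⁻¹ • ∑ t ∈ Finset.range T,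
        (inner ℝ (φ (X t ω)) (resolvent (lam T) T (fun s ↦ φ (X s ω)) f)) •
          (Y t ω - C (φ (X t ω)))‖} ⊆ {ω | (T * ε) ^ 2 ≤ ‖∑ t ∈ Finset.range T,
        (inner ℝ (φ (X t ω)) (resolvent (lam T) T (fun s ↦ φ (X s ω)) f)) •
          (Y t ω - C (φ (X t ω)))‖ ^ 2} := by
      intro ω hω
      simp only [Set.mem_ofPred_eq, norm_smul, norm_inv, Real.norm_natCast] at hω ⊢
      rw [le_inv_mul_iff₀ hT'] at hω
      gcongr
    refine (measureReal_mono hset).trans ?_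
    have h := (le_div_iff₀' (by positivity)).2 (hmarkov.trans hle)
    refine h.trans (le_of_eq ?_)
    field_simp
  rw [tendstoInMeasure_zero_iff]
  intro ε hε
  have hlim : Tendsto (fun T : ℕ ↦ (D ^ 2 * ‖f‖ ^ 2 / ε ^ 2) * ((T : ℝ) * lam T)⁻¹) atTop
      (𝓝 0) := by
    simpa using hTlam.inv_tendsto_atTop.const_mul (D ^ 2 * ‖f‖ ^ 2 / ε ^ 2)
  refine squeeze_zero' (.of_forall fun _ ↦ measureReal_nonneg) ?_ hlim
  filter_upwards [hTlam.eventually_gt_atTop 0, eventually_gt_atTop 0] with T h1 h2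
  exact hbound T h2 (pos_of_mul_pos_right h1 (Nat.cast_nonneg T)) ε hε

/-- Pointwise consistency of the regularized operator regression on the support of the inputs. -/
theorem tendstoInMeasure_empOperator {X : ℕ → Ω → 𝒳} {Y : ℕ → Ω → G}
    (hX : ∀ t, Measurable (X t)) (hY : ∀ t, Measurable (Y t))
    (hind : iIndepFun (fun t ω ↦ (X t ω, Y t ω)) μ)
    (hident : ∀ t, IdentDistrib (fun ω ↦ (X t ω, Y t ω)) (fun ω ↦ (X 0 ω, Y 0 ω)) μ μ)
    {B : ℝ} (hYB : ∀ᵐ ω ∂μ, ‖Y 0 ω‖ ≤ B) {φ : 𝒳 → F} (hφ : Continuous φ) {K : ℝ}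
    (hK : ∀ x, ‖φ x‖ ≤ K) {C : F →L[ℝ] G} (hC : IsCondEmbeddingOperator μ (Y 0) (X 0) φ C)
    {lam : ℕ → ℝ} (hlam : Tendsto lam atTop (𝓝 0))
    (hTlam : Tendsto (fun T : ℕ ↦ (T : ℝ) * lam T) atTop atTop)
    {x : 𝒳} (hx : x ∈ (μ.map (X 0)).support) :
    TendstoInMeasure μ (fun T ω ↦
      empOperator (lam T) T (fun t ↦ Y t ω) (fun t ↦ φ (X t ω)) (φ x) - C (φ x)) atTop
      (fun _ ↦ 0) := by
  have hpos : ∀ᶠ T in atTop, 0 < lam T := by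
    filter_upwards [hTlam.eventually_gt_atTop 0] with T h
    exact pos_of_mul_pos_right h (Nat.cast_nonneg T)
  have hbias := tendstoInMeasure_bias hX (hind.comp (fun _ ↦ Prod.fst) fun _ ↦ measurable_fst)
    (fun t ↦ (hident t).comp measurable_fst) hφ hlam hpos hx
  have hCbias : TendstoInMeasure μ (fun T ω ↦
      -C (lam T • resolvent (lam T) T (fun s ↦ φ (X s ω)) (φ x))) atTop (fun _ ↦ 0) := by
    refine tendstoInMeasure_zero_of_imp hbias fun ε hε ↦
      ⟨ε / (‖C‖ + 1), by positivity, .of_forall fun T ω hω ↦ ?_⟩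
    rw [norm_neg]
    rw [lt_div_iff₀ (by positivity)] at hω
    refine (C.le_opNorm _).trans_lt (lt_of_le_of_lt ?_ hω)
    rw [mul_comm]
    gcongr
    linarith
  have hsum := tendstoInMeasure_zero_add
    (tendstoInMeasure_noise hX hY hind hident hYB hφ hK hC hTlam (φ x)) hCbias
  refine tendstoInMeasure_zero_of_imp hsum fun ε hε ↦ ⟨ε, hε, ?_⟩
  filter_upwards [hpos] with T hl ω hω
  rwa [empOperator_apply_sub hl, sub_eq_add_neg]

end Consistency

/-! ### Continuous characteristic kernels on compact spaces -/

section Kernel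

variable {X : Type*} {H : Type*} [NormedAddCommGroup H] [InnerProductSpace ℝ H] [CompleteSpace H]
  [RKHS ℝ H X ℝ]

lemma IsInducedBy.mmd_le [MeasurableSpace X] {P : ProbabilityMeasure X} {ψ : H}
    (h : IsInducedBy P ψ) (Q : ProbabilityMeasure X) :
    mmd H (P : Measure X) (Q : Measure X) ≤ 2 * ‖ψ - kernelMean H (Q : Measure X)‖ := by
  have h1 := norm_sub_le_norm_sub_add_norm_sub (kernelMean H (P : Measure X)) ψ
    (kernelMean H (Q : Measure X))
  have h2 := h Q
  rw [norm_sub_rev (kernelMean H (Q : Measure X))] at h2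
  unfold mmd
  linarith

variable [TopologicalSpace X]

lemma continuous_rkhs_apply (hcont : Continuous (featureMap H : X → H)) (v : H) :
    Continuous fun x : X ↦ v x := by
  simp_rw [← inner_featureMap]
  exact continuous_const.inner hcont

variable [CompactSpace X]

lemma exists_norm_featureMap_le (hcont : Continuous (featureMap H : X → H)) :
    ∃ K, ∀ x : X, ‖featureMap H x‖ ≤ K := by
  obtain ⟨K, hK⟩ := (isCompact_range hcont.norm).bddAbove
  exact ⟨K, fun x ↦ hK ⟨x, rfl⟩⟩

/-- A reproducing kernel Hilbert space with continuous kernel on a compact space is separable,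
being spanned by the compact set of its features. -/
lemma secondCountableTopology_of_continuous_featureMap
    (hcont : Continuous (featureMap H : X → H)) : SecondCountableTopology H := by
  have hsep : TopologicalSpace.IsSeparable
      (Submodule.span ℝ (Set.range (featureMap H : X → H)) : Set H) :=
    (isCompact_range hcont).isSeparable.span
  have hdense : closure (Submodule.span ℝ (Set.range (featureMap H : X → H)) : Set H)
      = Set.univ := by
    rw [← Submodule.topologicalClosure_coe, ← Submodule.top_coe (R := ℝ), SetLike.coe_set_eq,
      eq_top_iff, ← RKHS.kerFun_dense (𝕜 := ℝ) (X := X) (V := ℝ) H]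
    refine Submodule.topologicalClosure_mono (Submodule.span_le.2 ?_)
    rintro _ ⟨x, v, rfl⟩
    have h : RKHS.kerFun H x v = v • featureMap H x := by
      rw [featureMap, ← map_smul, smul_eq_mul, mul_one]
    rw [h]
    exact Submodule.smul_mem _ _ (Submodule.subset_span ⟨x, rfl⟩)
  have := TopologicalSpace.isSeparable_univ_iff.1 (hdense ▸ hsep.closure)
  exact UniformSpace.secondCountable_of_separable H

variable [MeasurableSpace X] [BorelSpace X]

lemma integrable_featureMap (hcont : Continuous (featureMap H : X → H)) (P : Measure X)
    [IsFiniteMeasure P] : Integrable (featureMap H : X → H) P := by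
  have := secondCountableTopology_of_continuous_featureMap hcont
  obtain ⟨K, hK⟩ := exists_norm_featureMap_le hcont
  exact Integrable.of_bound hcont.aestronglyMeasurable K (.of_forall hK)

/-- A continuous characteristic kernel separates points, so that its feature map embeds the
compact space; in particular the space is metrizable and second countable. -/
lemma isClosedEmbedding_featureMap [T2Space X] (hcont : Continuous (featureMap H : X → H))
    (hchar : IsCharacteristic (X := X) H) : IsClosedEmbedding (featureMap H : X → H) := by
  refine hcont.isClosedEmbedding fun x y hxy ↦ ?_
  have h := hchar ⟨Measure.dirac x, inferInstance⟩ ⟨Measure.dirac y, inferInstance⟩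
    (by simpa [kernelMean] using hxy)
  exact dirac_eq_dirac_iff.1 (congrArg Subtype.val h)

lemma inner_kernelMean (hcont : Continuous (featureMap H : X → H)) (P : Measure X)
    [IsFiniteMeasure P] (v : H) : inner ℝ v (kernelMean H P) = ∫ x, v x ∂P := by
  rw [kernelMean, ← integral_inner (integrable_featureMap hcont P)]
  simp_rw [inner_featureMap]

/-- The kernel mean is continuous from the topology of convergence in distribution to the weak
topology of the Hilbert space. -/
lemma continuous_inner_kernelMean (hcont : Continuous (featureMap H : X → H)) (v : H) :
    Continuous fun P : ProbabilityMeasure X ↦ inner ℝ v (kernelMean H (P : Measure X)) := by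
  simp_rw [inner_kernelMean hcont]
  exact ProbabilityMeasure.continuous_integral_continuousMap
    (⟨fun x ↦ v x, continuous_rkhs_apply hcont v⟩ : C(X, ℝ))

/-- The distance of the kernel mean to `ψ` attains its minimum: it is lower semicontinuous on the
compact space of probability measures. -/
lemma exists_isInducedBy [T2Space X] [Nonempty X] (hcont : Continuous (featureMap H : X → H))
    (ψ : H) : ∃ P : ProbabilityMeasure X, IsInducedBy P ψ := by
  obtain ⟨x₀⟩ := ‹Nonempty X›
  have hlsc : LowerSemicontinuous
      fun P : ProbabilityMeasure X ↦ ‖kernelMean H (P : Measure X) - ψ‖ := by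
    intro P y hy
    rcases lt_or_ge y 0 with hy0 | hy0
    · exact .of_forall fun P' ↦ hy0.trans_le (norm_nonneg _)
    -- pairing with `v` gives a weakly continuous lower bound for the distance, sharp at `P`
    set v := kernelMean H (P : Measure X) - ψ with hv
    have hv0 : 0 < ‖v‖ := hy0.trans_lt hy
    have hP : ‖v‖ * y + inner ℝ v ψ < inner ℝ v (kernelMean H (P : Measure X)) := by
      have h1 := real_inner_self_eq_norm_sq v
      nth_rewrite 2 [hv] at h1
      rw [inner_sub_right] at h1
      nlinarith
    filter_upwards [(continuous_inner_kernelMean hcont v).continuousAt.eventually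
      (lt_mem_nhds hP)] with P' hP'
    have h1 := real_inner_le_norm v (kernelMean H (P' : Measure X) - ψ)
    rw [inner_sub_right] at h1
    exact lt_of_mul_lt_mul_left (by linarith) hv0.le
  obtain ⟨P, -, hP⟩ := (hlsc.lowerSemicontinuousOn Set.univ).exists_isMinOn
    ⟨⟨Measure.dirac x₀, inferInstance⟩, Set.mem_univ _⟩ isCompact_univ
  exact ⟨P, fun Q ↦ hP (Set.mem_univ Q)⟩

/-- The maximum mean discrepancy of a continuous characteristic kernel controls convergence in
distribution: on the compact space of probability measures, the pointwise values of the kernel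
mean already induce the topology. -/
lemma exists_pos_forall_mmd_lt [T2Space X] (hcont : Continuous (featureMap H : X → H))
    (hchar : IsCharacteristic (X := X) H) (f : C(X, ℝ)) (Q : ProbabilityMeasure X) {ε : ℝ}
    (hε : 0 < ε) :
    ∃ δ, 0 < δ ∧ ∀ P : ProbabilityMeasure X, mmd H (P : Measure X) (Q : Measure X) < δ →
      |∫ x, f x ∂(P : Measure X) - ∫ x, f x ∂(Q : Measure X)| < ε := by
  have := (isClosedEmbedding_featureMap hcont hchar).isEmbedding.metrizableSpace
  let J : ProbabilityMeasure X → X → ℝ := fun P x ↦ kernelMean H (P : Measure X) x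
  have hJcont : Continuous J := continuous_pi fun x ↦ by
    simp_rw [J, ← inner_featureMap, real_inner_comm]
    exact continuous_inner_kernelMean hcont _
  have hJemb : IsClosedEmbedding J :=
    hJcont.isClosedEmbedding fun P P' h ↦ hchar P P' (RKHS.ext fun x ↦ congrFun h x)
  -- the neighbourhoods of `Q` in the sense of the discrepancy
  let l : Filter (ProbabilityMeasure X) :=
    comap (fun P : ProbabilityMeasure X ↦ kernelMean H (P : Measure X))
      (𝓝 (kernelMean H (Q : Measure X)))
  have hl : Tendsto id l (𝓝 Q) := by
    rw [hJemb.isInducing.tendsto_nhds_iff]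
    refine tendsto_pi_nhds.2 fun x ↦ ?_
    exact ((RKHS.continuous_eval (𝕜 := ℝ) (H := H) (V := ℝ) x).tendsto
      (kernelMean H (Q : Measure X))).comp tendsto_comap
  have hint := ((ProbabilityMeasure.continuous_integral_continuousMap f).tendsto Q).comp hl
  have hmem := hint (Metric.ball_mem_nhds _ hε)
  obtain ⟨δ, hδ, h⟩ := (Metric.nhds_basis_ball.comap _).mem_iff.1 hmem
  refine ⟨δ, hδ, fun P hP ↦ ?_⟩
  have h1 := @h P (by simpa [mmd, dist_eq_norm] using hP)
  simpa [Real.dist_eq] using h1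

end Kernel

/-! ### Tensor features and marginals -/

section Tensor

variable {A S : Type*} {HA HS : Type*}
  [NormedAddCommGroup HA] [InnerProductSpace ℝ HA] [CompleteSpace HA] [RKHS ℝ HA A ℝ]
  [NormedAddCommGroup HS] [InnerProductSpace ℝ HS] [CompleteSpace HS] [RKHS ℝ HS S ℝ]
  [TopologicalSpace A] [TopologicalSpace S]

lemma continuous_tensorFeature (hA : Continuous (featureMap HA : A → HA))
    (hS : Continuous (featureMap HS : S → HS)) : Continuous (tensorFeature HA HS : A × S → _) :=
  (UniformSpace.Completion.continuous_coe _).comp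
    (TensorProduct.continuous_tmul.comp
      ((hS.comp continuous_snd).prodMk (hA.comp continuous_fst)))

end Tensor

/-- A coordinate of a point of the support lies in the support of the corresponding marginal. -/
lemma apply_mem_support_map {Ω J : Type*} [MeasurableSpace Ω] {μ : Measure Ω} {𝒳 : J → Type*}
    [∀ j, TopologicalSpace (𝒳 j)] [∀ j, MeasurableSpace (𝒳 j)]
    [∀ j, OpensMeasurableSpace (𝒳 j)] {X : Ω → ∀ j, 𝒳 j} (hX : Measurable X) {x : ∀ j, 𝒳 j}
    (hx : x ∈ (μ.map X).support) (j : J) : x j ∈ (μ.map fun ω ↦ X ω j).support := by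
  rw [Measure.support_eq_forall_isOpen]
  intro U hxU hU
  have hXj : Measurable fun ω ↦ X ω j := (measurable_pi_apply j).comp hX
  have h := (Measure.mem_support_iff_forall x).1 hx ((fun y ↦ y j) ⁻¹' U)
    ((hU.preimage (continuous_apply j)).mem_nhds hxU)
  rw [Measure.map_apply hX (measurable_pi_apply j hU.measurableSet)] at h
  rw [Measure.map_apply hXj hU.measurableSet]
  exact h

end GCE

/-! ### Consistency and convergence of the estimated embeddings -/

theorem mainTheorem1
    {N : ℕ} {Ω : Type*} [MeasurableSpace Ω] (μ : Measure Ω) [IsProbabilityMeasure μ]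
    -- observation, action and history spaces of the objects
    {Obs Act His : Fin N → Type*}
    [∀ i, TopologicalSpace (Obs i)] [∀ i, CompactSpace (Obs i)] [∀ i, T2Space (Obs i)]
    [∀ i, MeasurableSpace (Obs i)] [∀ i, BorelSpace (Obs i)]
    [∀ i, TopologicalSpace (Act i)] [∀ i, CompactSpace (Act i)] [∀ i, T2Space (Act i)]
    [∀ i, MeasurableSpace (Act i)] [∀ i, BorelSpace (Act i)]
    [∀ i, TopologicalSpace (His i)] [∀ i, CompactSpace (His i)] [∀ i, T2Space (His i)]
    [∀ i, MeasurableSpace (His i)] [∀ i, BorelSpace (His i)]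
    -- their reproducing kernel Hilbert spaces, with continuous characteristic kernels
    (HO HA HS : Fin N → Type*)
    [∀ i, NormedAddCommGroup (HO i)] [∀ i, InnerProductSpace ℝ (HO i)]
    [∀ i, CompleteSpace (HO i)] [∀ i, RKHS ℝ (HO i) (Obs i) ℝ]
    [∀ i, MeasurableSpace (HO i)] [∀ i, BorelSpace (HO i)]
    [∀ i, NormedAddCommGroup (HA i)] [∀ i, InnerProductSpace ℝ (HA i)]
    [∀ i, CompleteSpace (HA i)] [∀ i, RKHS ℝ (HA i) (Act i) ℝ]
    [∀ i, NormedAddCommGroup (HS i)] [∀ i, InnerProductSpace ℝ (HS i)]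
    [∀ i, CompleteSpace (HS i)] [∀ i, RKHS ℝ (HS i) (His i) ℝ]
    (hHO_cont : ∀ i, Continuous (GCE.featureMap (HO i) : Obs i → HO i))
    (hHA_cont : ∀ i, Continuous (GCE.featureMap (HA i) : Act i → HA i))
    (hHS_cont : ∀ i, Continuous (GCE.featureMap (HS i) : His i → HS i))
    (hHO_char : ∀ i, GCE.IsCharacteristic (X := Obs i) (HO i))
    (hHA_char : ∀ i, GCE.IsCharacteristic (X := Act i) (HA i))
    (hHS_char : ∀ i, GCE.IsCharacteristic (X := His i) (HS i))
    -- the adjacency matrix of the interaction graph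
    (e : Fin N → Fin N → Bool)
    -- the samples: observations, (action, history) inputs, and the components of the observation
    -- feature of object `i` that are attributable to object `j`
    (obs : ℕ → Ω → ∀ i, Obs i) (inp : ℕ → Ω → ∀ j, Act j × His j)
    (comp : ℕ → Ω → ∀ i, Fin N → HO i)
    (hobs : ∀ t, Measurable (obs t)) (hinp : ∀ t, Measurable (inp t))
    (hcomp : ∀ t, Measurable (comp t))
    (hcomp_bdd : ∃ B : ℝ, ∀ t i j, ∀ᵐ ω ∂μ, ‖comp t ω i j‖ ≤ B)
    (hindep : iIndepFun (fun t ω => (obs t ω, inp t ω, comp t ω)) μ)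
    (hident : ∀ t, IdentDistrib (fun ω => (obs t ω, inp t ω, comp t ω))
      (fun ω => (obs 0 ω, inp 0 ω, comp 0 ω)) μ μ)
    -- `κ i` is the conditional distribution of the observation of object `i` given all inputs
    (κ : ∀ i, Kernel (∀ j, Act j × His j) (Obs i)) [∀ i, IsMarkovKernel (κ i)]
    (hκ : ∀ i, μ.map (fun ω => (inp 0 ω, obs 0 ω i)) = (μ.map (inp 0)) ⊗ₘ (κ i))
    -- the conditional embedding operators, and the graph decomposition of the conditional mean
    (C : ∀ i j, GCE.HilbertTensor (HS j) (HA j) →L[ℝ] HO i)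
    (hC : ∀ i, ∀ j ∈ GCE.nbhd e i,
      GCE.IsCondEmbeddingOperator μ (fun ω => comp 0 ω i j) (fun ω => inp 0 ω j)
        (GCE.tensorFeature (HA j) (HS j)) (C i j))
    (hsum : ∀ i, ∀ x ∈ (μ.map (inp 0)).support,
      GCE.kernelMean (HO i) (κ i x) = GCE.neighbourSum HA HS e i (C i) x)
    -- Tikhonov regularization
    (lam : ℕ → ℝ) (hlam : Tendsto lam atTop (𝓝 0))
    (hTlam : Tendsto (fun T : ℕ => (T : ℝ) * lam T) atTop atTop)
    (i : Fin N) (x : ∀ j, Act j × His j) (hx : x ∈ (μ.map (inp 0)).support) :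
    let ψhat : ℕ → Ω → HO i := fun T ω =>
      GCE.estEmbedding HA HS e i (lam T) T (fun t => inp t ω) (fun t => comp t ω i) x
    -- convergence of the estimated embedding to the conditional mean embedding
    TendstoInMeasure μ (fun T ω => ‖ψhat T ω - GCE.kernelMean (HO i) (κ i x)‖) atTop
      (fun _ => (0 : ℝ)) ∧
    -- signed measures represented by the estimated embedding converge in MMD
    (∀ ν : ℕ → Ω → SignedMeasure (Obs i),
      (∀ T ω, GCE.signedKernelMean (HO i) (ν T ω) = ψhat T ω) →
      TendstoInMeasure μ (fun T ω => GCE.signedMMD (HO i) (ν T ω) (κ i x)) atTop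
        (fun _ => (0 : ℝ))) ∧
    -- induced probability measures exist, and converge in MMD and weakly
    (∀ T ω, ∃ P : ProbabilityMeasure (Obs i), GCE.IsInducedBy P (ψhat T ω)) ∧
    (∀ Phat : ℕ → Ω → ProbabilityMeasure (Obs i),
      (∀ T ω, GCE.IsInducedBy (Phat T ω) (ψhat T ω)) →
      TendstoInMeasure μ (fun T ω => GCE.mmd (HO i) (Phat T ω : Measure (Obs i)) (κ i x)) atTop
        (fun _ => (0 : ℝ)) ∧
      ∀ f : C(Obs i, ℝ),
        TendstoInMeasure μ (fun T ω => ∫ o, f o ∂(Phat T ω : Measure (Obs i))) atTop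
          (fun _ => ∫ o, f o ∂(κ i x))) := by
  intro ψhat
  have hOcount := fun j ↦ GCE.secondCountableTopology_of_continuous_featureMap (hHO_cont j)
  have hAcount : ∀ j, SecondCountableTopology (Act j) := fun j ↦ by
    have := GCE.secondCountableTopology_of_continuous_featureMap (hHA_cont j)
    exact (GCE.isClosedEmbedding_featureMap (hHA_cont j)
      (hHA_char j)).isEmbedding.secondCountableTopology
  have hScount : ∀ j, SecondCountableTopology (His j) := fun j ↦ by
    have := GCE.secondCountableTopology_of_continuous_featureMap (hHS_cont j)
    exact (GCE.isClosedEmbedding_featureMap (hHS_cont j)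
      (hHS_char j)).isEmbedding.secondCountableTopology
  obtain ⟨B, hB⟩ := hcomp_bdd
  have hinpj : ∀ j t, Measurable fun ω ↦ inp t ω j := fun j t ↦
    (measurable_pi_apply j).comp (hinp t)
  have hcompj : ∀ j t, Measurable fun ω ↦ comp t ω i j := fun j t ↦
    (measurable_pi_apply j).comp ((measurable_pi_apply i).comp (hcomp t))
  -- the estimator of each neighbour is consistent at its coordinate of the input
  have hj : ∀ j ∈ GCE.nbhd e i, TendstoInMeasure μ (fun T ω ↦
      GCE.empOperator (lam T) T (fun t ↦ comp t ω i j)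
        (fun t ↦ GCE.tensorFeature (HA j) (HS j) (inp t ω j))
        (GCE.tensorFeature (HA j) (HS j) (x j))
      - C i j (GCE.tensorFeature (HA j) (HS j) (x j))) atTop (fun _ ↦ 0) := by
    intro j hjn
    have hproj : Measurable fun s : (∀ i, Obs i) × (∀ j, Act j × His j) × (∀ i, Fin N → HO i) ↦
        (s.2.1 j, s.2.2 i j) := by fun_prop
    have hφ := GCE.continuous_tensorFeature (hHA_cont j) (hHS_cont j)
    obtain ⟨K, hK⟩ := (isCompact_range hφ.norm).bddAbove
    exact GCE.tendstoInMeasure_empOperator (hinpj j) (hcompj j)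
      (hindep.comp (fun _ s ↦ (s.2.1 j, s.2.2 i j)) fun _ ↦ hproj)
      (fun t ↦ (hident t).comp hproj) (hB 0 i j) hφ (fun y ↦ hK ⟨y, rfl⟩) (hC i j hjn) hlam hTlam
      (GCE.apply_mem_support_map (hinp 0) hx j)
  have hψ : TendstoInMeasure μ (fun T ω ↦ ψhat T ω - GCE.kernelMean (HO i) (κ i x)) atTop
      (fun _ ↦ 0) := by
    have hsum' : ∀ T ω, ψhat T ω - GCE.kernelMean (HO i) (κ i x) = ∑ j ∈ GCE.nbhd e i,
        (GCE.empOperator (lam T) T (fun t ↦ comp t ω i j)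
          (fun t ↦ GCE.tensorFeature (HA j) (HS j) (inp t ω j))
          (GCE.tensorFeature (HA j) (HS j) (x j))
        - C i j (GCE.tensorFeature (HA j) (HS j) (x j))) := fun T ω ↦ by
      rw [hsum i x hx, Finset.sum_sub_distrib]
      rfl
    simp_rw [hsum']
    exact GCE.tendstoInMeasure_zero_sum _ hj
  have hnorm : TendstoInMeasure μ (fun T ω ↦ ‖ψhat T ω - GCE.kernelMean (HO i) (κ i x)‖) atTop
      (fun _ ↦ (0 : ℝ)) :=
    GCE.tendstoInMeasure_zero_of_imp hψ fun ε hε ↦ ⟨ε, hε, .of_forall fun T ω h ↦ by simpa using h⟩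
  refine ⟨hnorm, fun ν hν ↦ ?_, fun T ω ↦ ?_, fun Phat hPhat ↦ ?_⟩
  · simpa only [GCE.signedMMD, hν] using hnorm
  · have : Nonempty (Obs i) := nonempty_of_isProbabilityMeasure (κ i x)
    exact GCE.exists_isInducedBy (hHO_cont i) _
  · let Q : ProbabilityMeasure (Obs i) := ⟨κ i x, inferInstance⟩
    have hmmd : TendstoInMeasure μ
        (fun T ω ↦ GCE.mmd (HO i) (Phat T ω : Measure (Obs i)) (κ i x)) atTop
        (fun _ ↦ (0 : ℝ)) := by
      refine GCE.tendstoInMeasure_zero_of_imp hψ fun ε hε ↦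
        ⟨ε / 2, half_pos hε, .of_forall fun T ω h ↦ ?_⟩
      have h1 : GCE.mmd (HO i) (Phat T ω : Measure (Obs i)) (κ i x)
          ≤ 2 * ‖ψhat T ω - GCE.kernelMean (HO i) (κ i x)‖ := (hPhat T ω).mmd_le Q
      have h0 : 0 ≤ GCE.mmd (HO i) (Phat T ω : Measure (Obs i)) (κ i x) := norm_nonneg _
      rw [Real.norm_of_nonneg h0]
      linarith
    refine ⟨hmmd, fun f ↦ ?_⟩
    have hdiff : TendstoInMeasure μ (fun T ω ↦
        ∫ o, f o ∂(Phat T ω : Measure (Obs i)) - ∫ o, f o ∂(κ i x)) atTop (fun _ ↦ (0 : ℝ)) := by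
      refine GCE.tendstoInMeasure_zero_of_imp hmmd fun ε hε ↦ ?_
      obtain ⟨δ, hδ, h⟩ := GCE.exists_pos_forall_mmd_lt (hHO_cont i) (hHO_char i) f Q hε
      refine ⟨δ, hδ, .of_forall fun T ω hω ↦ h (Phat T ω) ?_⟩
      exact (le_abs_self _).trans_lt hω
    rw [tendstoInMeasure_iff_norm] at hdiff ⊢
    simpa using hdiff
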